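/- **Setting.** Let $\mathcal X$ be a Polish space with its Borel $\sigma$-algebra, $\mathcal U$ a compact metrizable space of controls (e.g. a compact subset of $\mathbb R^p$), and $\mathrm{AP}$ a finite set of atomic propositions. A controlled Markov system $\mathbb{XU}=(\mathcal X,\mathcal U,\{\mathcal T\},\mathrm{AP},L_{\mathbb{XU}})$ consists of a nonempty collection $[\![\mathcal T^u]\!]$ of transition probabilities (Markov kernels) on $\mathcal X$ for each $u\in\mathcal U$ and a measurable labelling $L_{\mathbb{XU}}:\mathcal X\to 2^{\mathrm{AP}}$. A deterministic admissible policy $\phi$ is a sequence of measurable maps giving the control $\mathfrak u_t=\phi_t(X_{[0,t]},\mathfrak u_{[0,t-1]})$. For an initial distribution $\nu_0$, the set $\mathbb{XU}^\phi$ consists of all processes $(X_t,\mathfrak u_t)_{t\ge0}$ such that $X_0\sim\nu_0$, a.s. $\mathfrak u_t=\phi_t(X_{[0,t]},\mathfrak u_{[0,t-1]})$ for all $t$, and for every $t$, a.s., the conditional law of $X_{t+1}$ given $(X_{[0,t]},\mathfrak u_{[0,t]})$ is $\mathcal T(X_t,\cdot)$ for some $\mathcal T\in[\![\mathcal T^{\mathfrak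 u_t}]\!]$, whose choice may depend on $t$ and on that history. For an $\omega$-regular $\Psi\subseteq(2^{\mathrm{AP}})^\omega$ (the language of a finite nondeterministic Büchi automaton), $\rho\in[0,1]$ and ${\bowtie}\in\{\le,<,\ge,>\}$, write $X^\phi\vDash\mathbf P^{\nu_0,\phi}_{\bowtie\rho}[\Psi]$ if the probability that $L_{\mathbb{XU}}(X_0)L_{\mathbb{XU}}(X_1)\cdots\in\Psi$ is $\bowtie\rho$. A BMDP has a finite state set $\mathcal Q$, a finite action set $\mathit{Act}$, a labelling $L_{\mathbb{IA}}:\mathcal Q\to2^{\mathrm{AP}}$ and real matrices $\check\Theta^a,\hat\Theta^a$ indexed by $\mathcal Q\times\mathcal Q$ for each $a\in\mathit{Act}$. It induces the controlled Markov system $\mathbb{IA}$ on $\mathcal Q$ in which $[\![\Theta^a]\!]$ is the set of all stochastic matrices $\Theta$ with $\check\Theta^a\le\Theta\le\hat\Theta^a$ entrywise; its policies and processes are defined as above, and those started at $q_0\in\mathcal Q$ have initial law $\delta_{q_0}$. We call $\mathbb{IA}$ a BMDP abstraction of $\mathbb{XU}$ if there are a relation $\alpha\subseteq\mathcal X\times\mathcal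 Q$ and a relation $\Sigma_\alpha$ between probability measures on $\mathcal X$ and on $\mathcal Q$ such that 1. the sets $\alpha^{-1}(q)=\{x:(x,q)\in\alpha\}$, $q\in\mathcal Q$, are measurable and each $x\in\mathcal X$ lies in exactly one of them; and for all $x$ there is $q$ with $(x,q)\in\alpha$ and $L_{\mathbb{IA}}(q)=L_{\mathbb{XU}}(x)$; 2. for all $q\in\mathcal Q$ and $a\in\mathit{Act}$ there is $u\in\mathcal U$ such that for every $\mathcal T\in[\![\mathcal T^u]\!]$ and every $x\in\alpha^{-1}(q)$ there is $\Theta\in[\![\Theta^a]\!]$ with $(\mathcal T(x,\cdot),\Theta_{q})\in\Sigma_\alpha$ and $\mathcal T(x,\alpha^{-1}(q'))=\Theta_{qq'}$ for all $q'\in\mathcal Q$. **Statement.** Let $\mathbb{IA}$ be a BMDP abstraction of $\mathbb{XU}$ through $\alpha,\Sigma_\alpha$, let $\Psi$ be $\omega$-regular, $\rho\in[0,1]$, ${\bowtie}\in\{\le,<,\ge,>\}$ and $q_0\in\mathcal Q$. Suppose there is a deterministic admissible policy $\kappa$ of $\mathbb{IA}$ such that $I^\kappa\vDash\mathcal P^{q_0,\kappa}_{\bowtie\rho}[\Psi]$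 for every process $I^\kappa\in\mathbb{IA}^\kappa$ started at $q_0$. Then there is a deterministic admissible policy $\phi$ of $\mathbb{XU}$ such that, for every initial distribution $\nu_0$ with $\nu_0(\alpha^{-1}(q_0))=1$, there is at least one process $X^\phi\in\mathbb{XU}^\phi$ with initial law $\nu_0$, and every such process satisfies $X^\phi\vDash\mathbf P^{\nu_0,\phi}_{\bowtie\rho}[\Psi]$. -/

import Mathlib

open MeasureTheory ProbabilityTheory

/-- A transition probability on `X`, i.e. a Markov kernel. On a finite discrete space this is a
stochastic matrix. -/
abbrev TransitionProb (X : Type*) [MeasurableSpace X] :=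
  {T : Kernel X X // IsMarkovKernel T}

/-- The measure `T(x, ·)`; for a stochastic matrix, its row with index `x`. -/
def TransitionProb.row {X : Type*} [MeasurableSpace X] (T : TransitionProb X) (x : X) :
    ProbabilityMeasure X :=
  ⟨T.1 x, T.2.isProbabilityMeasure x⟩

/-- A (labelled) controlled Markov system with state space `X`, control space `U` and atomic
propositions `AP`: every control value `u` comes with a collection of transition probabilities,
and states are labelled measurably by subsets of `AP`. -/
structure ControlledMarkovSystem (X U AP : Type*) [MeasurableSpace X] where
  /-- The collection of the transition probabilities that are possible under the control `u`. -/
  trans : U → Set (TransitionProb X)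
  label : X → Set AP
  measurable_label : Measurable label

/-- A deterministic admissible control policy: the control value at time `t` is a measurable
function of the states at the times `0, …, t` and the control values at the times
`0, …, t - 1`. -/
structure ControlPolicy (X U : Type*) [MeasurableSpace X] [MeasurableSpace U] where
  rule : (t : ℕ) → (Fin (t + 1) → X) × (Fin t → U) → U
  measurable_rule : ∀ t, Measurable (rule t)

namespace ControlledMarkovSystem

variable {X U AP : Type*} [MeasurableSpace X] [MeasurableSpace U]

/-- The processes that the system generates under the policy `φ` from the initial distribution
`ν₀`, given by the joint law `P` of states and controls on the canonical space `(X × U)^∞`: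
the initial state has law `ν₀`, the controls follow `φ`, and at each time `t`, given the history
up to time `t`, the next state is distributed according to a transition probability that is chosen
(possibly in dependence on that history) from the collection of the current control value. -/
def laws [StandardBorelSpace X] [Nonempty X] (S : ControlledMarkovSystem X U AP)
    (φ : ControlPolicy X U) (ν₀ : ProbabilityMeasure X) :
    Set (ProbabilityMeasure (ℕ → X × U)) :=
  {P | (P : Measure (ℕ → X × U)).map (fun ω => (ω 0).1) = (ν₀ : Measure X) ∧
    (∀ t : ℕ, ∀ᵐ ω ∂(P : Measure (ℕ → X × U)),
      (ω t).2 = φ.rule t (fun i => (ω i).1, fun i => (ω i).2)) ∧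
    (∀ t : ℕ, ∀ᵐ ω ∂(P : Measure (ℕ → X × U)), ∃ T ∈ S.trans (ω t).2,
      condDistrib (fun ω' : ℕ → X × U => (ω' (t + 1)).1)
        (fun (ω' : ℕ → X × U) (i : Fin (t + 1)) => ω' i) (P : Measure (ℕ → X × U))
        (fun i : Fin (t + 1) => ω i) = T.1 (ω t).1)}

/-- The event that the trace of the controlled path belongs to the linear-time property `Ψ`. -/
def satEvent (S : ControlledMarkovSystem X U AP) (Ψ : Set (ℕ → Set AP)) :
    Set (ℕ → X × U) :=
  {ω | (fun t => S.label (ω t).1) ∈ Ψ}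

end ControlledMarkovSystem

/-- The comparison signs `≤`, `<`, `≥`, `>`. -/
inductive Comparison
  | le
  | lt
  | ge
  | gt

/-- `c.holds p ρ` means `p ⋈ ρ`. -/
def Comparison.holds : Comparison → ℝ → ℝ → Prop
  | .le, p, ρ => p ≤ ρ
  | .lt, p, ρ => p < ρ
  | .ge, p, ρ => p ≥ ρ
  | .gt, p, ρ => p > ρ

/-- The process with joint law `P` satisfies the probabilistic specification `P_{⋈ρ}[Ψ]`. -/
def ControlledMarkovSystem.Satisfies {X U AP : Type*} [MeasurableSpace X] [MeasurableSpace U]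
    (S : ControlledMarkovSystem X U AP) (P : ProbabilityMeasure (ℕ → X × U))
    (c : Comparison) (ρ : ℝ) (Ψ : Set (ℕ → Set AP)) : Prop :=
  c.holds ((P : Measure (ℕ → X × U)).real (S.satEvent Ψ)) ρ

/-- `Ψ` is an ω-regular set of infinite words: it is the language of a nondeterministic Büchi
automaton with finitely many states. -/
def IsOmegaRegular {A : Type*} (Ψ : Set (ℕ → A)) : Prop :=
  ∃ (m : ℕ) (init : Set (Fin m)) (step : Fin m → A → Set (Fin m)) (acc : Set (Fin m)),
    Ψ = {w | ∃ r : ℕ → Fin m, r 0 ∈ init ∧ (∀ t, r (t + 1) ∈ step (r t) (w t)) ∧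
      ∀ n, ∃ t, n ≤ t ∧ r t ∈ acc}

/-- A bounded-parameter Markov decision process with finite state space `Q` and finite action
space `Act`: entrywise lower and upper bounds for the transition matrices of each action. -/
structure BMDP (Q Act AP : Type*) where
  lower : Act → Matrix Q Q ℝ
  upper : Act → Matrix Q Q ℝ
  label : Q → Set AP

/-- The controlled Markov system induced by a BMDP: the collection of an action consists of all
stochastic matrices that lie entrywise between the bounds. -/
def BMDP.toSystem {Q Act AP : Type*} [MeasurableSpace Q] [DiscreteMeasurableSpace Q]
    (B : BMDP Q Act AP) : ControlledMarkovSystem Q Act AP where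
  trans a := {Θ | ∀ i j, B.lower a i j ≤ (Θ.1 i).real {j} ∧ (Θ.1 i).real {j} ≤ B.upper a i j}
  label := B.label
  measurable_label := Measurable.of_discrete

/-- The set `α⁻¹(q)` of the states that are related to `q`. -/
def relPreimage {X Q : Type*} (α : Set (X × Q)) (q : Q) : Set X :=
  {x | (x, q) ∈ α}

/-- The relation `α` comes from a partition of `X` into measurable cells `α⁻¹(q)`. -/
def IsMeasurablePartition {X Q : Type*} [MeasurableSpace X] (α : Set (X × Q)) : Prop :=
  (∀ x, ∃! q, (x, q) ∈ α) ∧ ∀ q, MeasurableSet (relPreimage α q)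

/-- `IA` abstracts `XU` through the state-level relation `α` and the measure-level relation `R`. -/
structure Abstracts {X U Q Act AP : Type*} [MeasurableSpace X] [MeasurableSpace Q]
    (XU : ControlledMarkovSystem X U AP) (IA : ControlledMarkovSystem Q Act AP)
    (α : Set (X × Q)) (R : Set (ProbabilityMeasure X × ProbabilityMeasure Q)) : Prop where
  state_level : ∀ x, ∃ q, (x, q) ∈ α ∧ IA.label q = XU.label x
  measure_level : ∀ (q : Q) (a : Act), ∃ u : U, ∀ T ∈ XU.trans u, ∀ x ∈ relPreimage α q,
    ∃ Θ ∈ IA.trans a, (T.row x, Θ.row q) ∈ R ∧ ∀ q', T.1 x (relPreimage α q') = Θ.1 q {q'}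

/-!
The concrete policy runs the abstract policy `κ` on the cells visited so far and applies the control
that implements the current cell and action. Any law generated by this policy is pushed forward to
abstract controlled paths, and the claim is that the result is a law generated under `κ`. The only
point is the conditional law of the next cell: an abstract history merges many concrete histories,
so that conditional law is an average of rows, each of which respects the interval bounds of the
current cell and action. Interval bounds are closed and convex, so the average respects them as
well. Since labels are preserved, the probability of `Ψ` is the same for both laws.

This uses that `Ψ` is measurable. A Büchi automaton accepts `w` iff some state `p` recurs with
accepting loops at times that pairwise merge, i.e. whose later behaviours agree from some time on;
such loops can be recombined freely, which turns the existence of one infinite run into a countable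
combination of conditions on finite prefixes of `w`.
-/

section OmegaRegular

open Filter Set

variable {A S : Type*} {M : NFA A S} {C : Set S} {w : ℕ → A} {r r' : ℕ → S}

/-- The Büchi language of `M`: the infinite words with a run from a start state that visits the
accepting states infinitely often. -/
def buchiLanguage (M : NFA A S) : Set (ℕ → A) :=
  {w | ∃ r : ℕ → S, r 0 ∈ M.start ∧ (∀ t, r (t + 1) ∈ M.step (r t) (w t)) ∧
    ∀ n, ∃ t, n ≤ t ∧ r t ∈ M.accept}

/-- `r` follows the transitions of `M` on the input `w` at the times in `I`. -/
def IsRunOn (M : NFA A S) (w : ℕ → A) (I : Set ℕ) (r : ℕ → S) : Prop :=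
  ∀ t ∈ I, r (t + 1) ∈ M.step (r t) (w t)

/-- A run on `w` leads from the state `p` at time `i` to the state `q` at time `k` and is in `C`
at some time in `[i, k)`. For `C = univ` this is reachability by a nonempty run. -/
def ReachesThrough (M : NFA A S) (C : Set S) (w : ℕ → A) (i k : ℕ) (p q : S) : Prop :=
  ∃ r, IsRunOn M w (Ico i k) r ∧ r i = p ∧ r k = q ∧ ∃ t ∈ Ico i k, r t ∈ C

/-- The input read between `i` and `k` and the input read between `j` and `k` induce the same
transitions of `M`, both plain and through accepting states. -/
def MergesAt (M : NFA A S) (w : ℕ → A) (k i j : ℕ) : Prop :=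
  ∀ C ∈ ({univ, M.accept} : Set (Set S)), ReachesThrough M C w i k = ReachesThrough M C w j k

theorem IsRunOn.mono {I J : Set ℕ} (h : IsRunOn M w J r) (hIJ : I ⊆ J) : IsRunOn M w I r :=
  fun t ht => h t (hIJ ht)

theorem IsRunOn.exists_concat {I : Set ℕ} {j : ℕ} (h : IsRunOn M w (I ∩ Iio j) r)
    (h' : IsRunOn M w (I ∩ Ici j) r') (hj : r j = r' j) :
    ∃ s, IsRunOn M w I s ∧ EqOn s r (Iic j) ∧ EqOn s r' (Ici j) := by
  classical
  have heq : EqOn ((Iic j).piecewise r r') r' (Ici j) := fun t ht => by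
    rcases (mem_Ici.1 ht).eq_or_lt with rfl | ht
    · rw [piecewise_eq_of_mem _ _ _ self_mem_Iic, hj]
    · exact piecewise_eq_of_notMem _ _ _ ht.not_ge
  refine ⟨(Iic j).piecewise r r', fun t ht => ?_, piecewise_eqOn _ _ _, heq⟩
  rcases lt_or_ge t j with htj | hjt
  · rw [piecewise_eq_of_mem _ _ _ (show t + 1 ∈ Iic j from htj),
      piecewise_eq_of_mem _ _ _ (mem_Iic.2 htj.le)]
    exact h t ⟨ht, htj⟩
  · rw [heq hjt, heq (hjt.trans t.le_succ)]
    exact h' t ⟨ht, hjt⟩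

theorem IsRunOn.exists_iterated_concat {g : ℕ → ℕ} (hg : StrictMono g) {r : ℕ → ℕ → S}
    (hr : ∀ i, IsRunOn M w (Ico (g i) (g (i + 1))) (r i))
    (hglue : ∀ i, r i (g (i + 1)) = r (i + 1) (g (i + 1))) :
    ∃ s, IsRunOn M w (Ici (g 0)) s ∧ ∀ i, EqOn s (r i) (Icc (g i) (g (i + 1))) := by
  classical
  have hex : ∀ t, ∃ i, t < g (i + 1) := fun t => ⟨t, Nat.lt_of_succ_le hg.le_apply⟩
  have hfind : ∀ i, ∀ t ∈ Ico (g i) (g (i + 1)), Nat.find (hex t) = i := fun i t ht =>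
    (Nat.find_eq_iff _).2 ⟨ht.2, fun n hn =>
      ((hg.monotone (Nat.succ_le_of_lt hn)).trans ht.1).not_gt⟩
  let s (t : ℕ) : S := r (Nat.find (hex t)) t
  have heq : ∀ i, EqOn s (r i) (Icc (g i) (g (i + 1))) := by
    rintro i t ⟨hit, hti⟩
    rcases hti.eq_or_lt with rfl | hti
    · simp only [s, hfind (i + 1) _ ⟨le_rfl, hg (i + 1).lt_succ_self⟩, hglue]
    · simp only [s, hfind i t ⟨hit, hti⟩]
  refine ⟨s, fun t ht => ?_, heq⟩
  have hlt : t < g (Nat.find (hex t) + 1) := Nat.find_spec (hex t)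
  have hle : g (Nat.find (hex t)) ≤ t := by
    rcases h : Nat.find (hex t) with _ | n
    · exact ht
    · exact not_lt.1 (Nat.find_min (hex t) (h ▸ n.lt_succ_self))
  rw [heq _ ⟨hle.trans t.le_succ, hlt⟩]
  exact hr _ t ⟨hle, hlt⟩

theorem IsRunOn.reachesThrough {i k t : ℕ} (h : IsRunOn M w (Ico i k) r) (ht : t ∈ Ico i k)
    (hC : r t ∈ C) : ReachesThrough M C w i k (r i) (r k) :=
  ⟨r, h, rfl, rfl, t, ht, hC⟩

theorem reachesThrough_iff_exists {i j k : ℕ} (hij : i < j) (hjk : j < k) (p q : S) :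
    ReachesThrough M C w i k p q ↔
      ∃ s, (ReachesThrough M C w i j p s ∧ ReachesThrough M univ w j k s q) ∨
        (ReachesThrough M univ w i j p s ∧ ReachesThrough M C w j k s q) := by
  constructor
  · rintro ⟨r, hr, rfl, rfl, t, ⟨hit, htk⟩, htC⟩
    have hr₁ : IsRunOn M w (Ico i j) r := hr.mono (Ico_subset_Ico_right hjk.le)
    have hr₂ : IsRunOn M w (Ico j k) r := hr.mono (Ico_subset_Ico_left hij.le)
    refine ⟨r j, (lt_or_ge t j).imp (fun htj => ?_) fun hjt => ?_⟩
    · exact ⟨hr₁.reachesThrough ⟨hit, htj⟩ htC,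
        hr₂.reachesThrough (left_mem_Ico.2 hjk) (mem_univ _)⟩
    · exact ⟨hr₁.reachesThrough (left_mem_Ico.2 hij) (mem_univ _),
        hr₂.reachesThrough ⟨hjt, htk⟩ htC⟩
  · have concat : ∀ r r' : ℕ → S, IsRunOn M w (Ico i j) r → IsRunOn M w (Ico j k) r' →
        r j = r' j → ∃ s, IsRunOn M w (Ico i k) s ∧ EqOn s r (Iic j) ∧ EqOn s r' (Ici j) :=
      fun r r' hr hr' => IsRunOn.exists_concat (hr.mono fun _ h => ⟨h.1.1, h.2⟩)
        (hr'.mono fun _ h => ⟨h.2, h.1.2⟩)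
    rintro ⟨_, ⟨⟨r, hr, rfl, rfl, t, ht, htC⟩, r', hr', hj, rfl, -⟩ |
      ⟨⟨r, hr, rfl, rfl, -⟩, r', hr', hj, rfl, t, ht, htC⟩⟩ <;>
    obtain ⟨s, hs, hsr, hsr'⟩ := concat r r' hr hr' hj.symm <;>
    rw [← hsr hij.le, ← hsr' hjk.le]
    · exact hs.reachesThrough ⟨ht.1, ht.2.trans hjk⟩ (by rwa [hsr ht.2.le])
    · exact hs.reachesThrough ⟨hij.le.trans ht.1, ht.2⟩ (by rwa [hsr' ht.1])

theorem MergesAt.mono {i j k l : ℕ} (h : MergesAt M w k i j) (hi : i < k) (hj : j < k)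
    (hkl : k ≤ l) : MergesAt M w l i j := by
  rcases hkl.eq_or_lt with rfl | hkl
  · exact h
  · intro C hC
    ext p q
    rw [reachesThrough_iff_exists hi hkl, reachesThrough_iff_exists hj hkl, h C hC,
      h univ (mem_insert _ _)]

theorem exists_run_of_frequently_mergesAt {n : ℕ} {p : S}
    (h : ∀ N, ∃ j, N < j ∧ ReachesThrough M M.accept w n j p p ∧ ∃ k > j, MergesAt M w k n j) :
    ∃ s, s n = p ∧ IsRunOn M w (Ici n) s ∧ ∀ N, ∃ t, N ≤ t ∧ s t ∈ M.accept := by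
  let Good : Set ℕ := {j | n ≤ j ∧ ∃ k > j, MergesAt M w k n j}
  have exists_next : ∀ j : Good, ∃ j' : Good,
      j.1 < j'.1 ∧ ReachesThrough M M.accept w j j' p p := by
    rintro ⟨j, hnj, k, hjk, hmerge⟩
    obtain ⟨j', hkj', hreach, hgood⟩ := h k
    refine ⟨⟨j', by omega, hgood⟩, hjk.trans hkj', ?_⟩
    rwa [hmerge.mono (hnj.trans_lt hjk) hjk hkj'.le _ (mem_insert_of_mem _ rfl)] at hreach
  choose next hlt hreach using exists_next
  let g : ℕ → Good := fun i => next^[i] ⟨n, le_rfl, n + 1, n.lt_succ_self, fun _ _ => rfl⟩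
  have hg : ∀ i, g (i + 1) = next (g i) := fun i => Function.iterate_succ_apply' _ _ _
  have hmono : StrictMono fun i => (g i).1 := strictMono_nat_of_lt_succ fun i => hg i ▸ hlt _
  have hloop : ∀ i, ReachesThrough M M.accept w (g i) (g (i + 1)) p p := fun i =>
    hg i ▸ hreach _
  choose r hr hleft hright t ht hacc using hloop
  obtain ⟨s, hs, hsr⟩ :=
    IsRunOn.exists_iterated_concat hmono hr fun i => (hright i).trans (hleft (i + 1)).symm
  refine ⟨s, (hsr 0 (left_mem_Icc.2 (hmono Nat.zero_lt_one).le)).trans (hleft 0), hs,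
    fun N => ⟨t N, hmono.le_apply.trans (ht N).1, ?_⟩⟩
  rw [hsr N (Ico_subset_Icc_self (ht N))]
  exact hacc N

/-- Every time has a limit profile along an ultrafilter; two times with the same limit profile
merge at arbitrarily late times. -/
theorem exists_infinite_mergesAt [Finite S] (M : NFA A S) (w : ℕ → A) (r : ℕ → S) :
    ∃ (p : S) (J : Set ℕ), J.Infinite ∧
      ∀ i ∈ J, r i = p ∧ ∀ j ∈ J, ∃ k > j, MergesAt M w k i j := by
  let profile (k t : ℕ) : Set S → S → S → Prop := fun C => ReachesThrough M C w t k
  have hlim : ∀ t, ∃ c, ∀ᶠ k in (hyperfilter ℕ : Filter ℕ), profile k t = c := fun t =>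
    Ultrafilter.eventually_exists_iff.1 (.of_forall fun k => ⟨profile k t, rfl⟩)
  choose limProfile hlim using hlim
  obtain ⟨y, hy⟩ := Finite.exists_infinite_fiber fun t => (r t, limProfile t)
  refine ⟨y.1, _, infinite_coe_iff.1 hy, fun i hi => ⟨congrArg Prod.fst hi, fun j hj => ?_⟩⟩
  have hij : limProfile i = limProfile j := congrArg Prod.snd (hi.trans hj.symm)
  have hgt : ∀ᶠ k in (hyperfilter ℕ : Filter ℕ), j < k :=
    Nat.hyperfilter_le_atTop (eventually_gt_atTop j)
  obtain ⟨k, hik, hjk, hk⟩ := ((hlim i).and ((hlim j).and hgt)).exists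
  exact ⟨k, hk, fun C _ => congrFun (hik.trans (hij.trans hjk.symm)) C⟩

/-- The condition on the right only involves countably many finite prefixes of `w`. -/
theorem mem_buchiLanguage_iff [Finite S] :
    w ∈ buchiLanguage M ↔
      ∃ (n : ℕ) (p p₀ : S), (p₀ ∈ M.start ∧ ReachesThrough M univ w 0 n p₀ p) ∧
        ∀ N, ∃ j, N < j ∧ ReachesThrough M M.accept w n j p p ∧ ∃ k > j, MergesAt M w k n j := by
  constructor
  · rintro ⟨r, h₀, hstep, hacc⟩
    have hrun : ∀ I, IsRunOn M w I r := fun I t _ => hstep t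
    obtain ⟨p, J, hJ, hmerge⟩ := exists_infinite_mergesAt M w r
    obtain ⟨n, hn, hn₀⟩ := hJ.exists_gt 0
    refine ⟨n, p, r 0, ⟨h₀, ?_⟩, fun N => ?_⟩
    · exact (hmerge n hn).1 ▸ (hrun _).reachesThrough (left_mem_Ico.2 hn₀) (mem_univ _)
    · obtain ⟨t, hnt, ht⟩ := hacc n
      obtain ⟨j, hj, hlt⟩ := hJ.exists_gt (max N t)
      have hloop := (hrun _).reachesThrough ⟨hnt, (le_max_right N t).trans_lt hlt⟩ ht
      rw [(hmerge n hn).1, (hmerge j hj).1] at hloop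
      exact ⟨j, (le_max_left N t).trans_lt hlt, hloop, (hmerge n hn).2 j hj⟩
  · rintro ⟨n, p, _, ⟨h₀, r, hr, rfl, rfl, -⟩, h⟩
    obtain ⟨r', hglue, hr', hacc⟩ := exists_run_of_frequently_mergesAt h
    obtain ⟨s, hs, hsr, hsr'⟩ := IsRunOn.exists_concat (I := univ)
      (hr.mono fun t ht => ⟨t.zero_le, ht.2⟩) (hr'.mono inter_subset_right) hglue.symm
    refine ⟨s, hsr n.zero_le ▸ h₀, fun t => hs t (mem_univ t), fun N => ?_⟩
    obtain ⟨t, ht, hta⟩ := hacc (max N n)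
    exact ⟨t, (le_max_left N n).trans ht, by rwa [hsr' ((le_max_right N n).trans ht)]⟩

theorem measurableSet_of_forall_eqOn_Iio [Finite A] [MeasurableSpace A]
    [MeasurableSingletonClass A] {s : Set (ℕ → A)} (k : ℕ)
    (h : ∀ w ∈ s, ∀ w', EqOn w w' (Iio k) → w' ∈ s) : MeasurableSet s := by
  let restrict (w : ℕ → A) (i : Fin k) : A := w i
  have hs : restrict ⁻¹' (restrict '' s) = s := by
    refine (subset_preimage_image _ s).antisymm' ?_
    rintro w' ⟨w, hw, hww'⟩
    exact h w hw w' fun t ht => congrFun hww' ⟨t, ht⟩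
  rw [← hs]
  exact (toFinite _).measurableSet.preimage (by fun_prop)

theorem reachesThrough_congr {w' : ℕ → A} {i k : ℕ} (h : EqOn w w' (Iio k)) :
    ReachesThrough M C w i k = ReachesThrough M C w' i k := by
  have hrun : ∀ r, IsRunOn M w (Ico i k) r ↔ IsRunOn M w' (Ico i k) r := fun r =>
    forall₂_congr fun t ht => by rw [h ht.2]
  unfold ReachesThrough
  simp only [hrun]

theorem measurableSet_buchiLanguage [Finite S] [Finite A] [MeasurableSpace A]
    [MeasurableSingletonClass A] (M : NFA A S) : MeasurableSet (buchiLanguage M) := by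
  have hreach : ∀ C i k p q, Measurable fun w => ReachesThrough M C w i k p q :=
    fun C i k p q => measurableSet_setOfPred.1 <|
      measurableSet_of_forall_eqOn_Iio k fun w hw w' h => by
        rwa [mem_ofPred_eq, ← reachesThrough_congr h]
  have hmerge : ∀ k i j, Measurable fun w => MergesAt M w k i j :=
    fun k i j => measurableSet_setOfPred.1 <|
      measurableSet_of_forall_eqOn_Iio k fun w hw w' h => by
        simpa only [mem_ofPred_eq, MergesAt, reachesThrough_congr h] using hw
  have hmem : Measurable fun w => w ∈ buchiLanguage M := by
    simp only [mem_buchiLanguage_iff]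
    exact .exists fun n => .exists fun p => .exists fun p₀ =>
      .and (.and measurable_const (hreach ..)) <| .forall fun N => .exists fun j =>
        .and measurable_const <| .and (hreach ..) <| .exists fun k =>
          .and measurable_const (hmerge ..)
  exact measurableSet_setOfPred.2 hmem

theorem IsOmegaRegular.measurableSet [Finite A] [MeasurableSpace A] [MeasurableSingletonClass A]
    {Ψ : Set (ℕ → A)} (hΨ : IsOmegaRegular Ψ) : MeasurableSet Ψ := by
  obtain ⟨m, start, step, accept, rfl⟩ := hΨ
  exact measurableSet_buchiLanguage ⟨step, start, accept⟩

end OmegaRegular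

section CountableRange

variable {Ω X Z U : Type*} [MeasurableSpace Ω] [MeasurableSpace X] [MeasurableSpace Z]
  [MeasurableSpace U] [MeasurableSingletonClass U]

theorem measurableSet_eq_of_countable_range {f g : Ω → U} (hf : Measurable f) (hg : Measurable g)
    (hcount : (Set.range g).Countable) : MeasurableSet {ω | f ω = g ω} := by
  have hset : {ω | f ω = g ω} = ⋃ u ∈ Set.range g, f ⁻¹' {u} ∩ g ⁻¹' {u} := by
    ext ω
    simpa [eq_comm] using fun h : f ω = g ω => ⟨ω, h⟩
  rw [hset]
  exact .biUnion hcount fun u _ =>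
    (hf (measurableSet_singleton u)).inter (hg (measurableSet_singleton u))

theorem measurable_apply_of_countable_range {u : Ω → U} {x : Ω → X} {F : U → X → Z}
    (hu : Measurable u) (hx : Measurable x) (hF : ∀ v, Measurable (F v))
    (hcount : (Set.range u).Countable) : Measurable fun ω => F (u ω) (x ω) := by
  have : Countable (Set.range u) := hcount
  have hF' : Measurable fun p : Set.range u × X => F p.1 p.2 :=
    measurable_from_prod_countable_right fun v => hF v
  exact hF'.comp ((hu.subtype_mk (h := Set.mem_range_self)).prodMk hx)

end CountableRange

section History

variable {Y Z : Type*} {t i : ℕ}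

/-- The restriction of an infinite path to the times `0, …, t`. -/
def history (t : ℕ) (z : ℕ → Z) (i : Fin (t + 1)) : Z := z i

/-- The infinite path that follows a finite history and then stays at its last value. It serves to
evaluate causal path transformations on histories. -/
def extendHistory (h : Fin (t + 1) → Z) (n : ℕ) : Z :=
  h ⟨min n t, Nat.lt_succ_of_le (min_le_right n t)⟩

theorem extendHistory_history_of_le (z : ℕ → Z) (hi : i ≤ t) :
    extendHistory (history t z) i = z i :=
  congrArg z (min_eq_left hi)

@[fun_prop]
theorem measurable_history [MeasurableSpace Z] (t : ℕ) :
    Measurable (history t : (ℕ → Z) → Fin (t + 1) → Z) :=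
  measurable_pi_lambda _ fun _ => measurable_pi_apply _

@[fun_prop]
theorem measurable_extendHistory [MeasurableSpace Z] (t : ℕ) :
    Measurable (extendHistory : (Fin (t + 1) → Z) → ℕ → Z) :=
  measurable_pi_lambda _ fun _ => measurable_pi_apply _

/-- A transformation of paths is causal if its value at time `t` only depends on the argument up to
time `t`. -/
def IsCausal (F : (ℕ → Y) → ℕ → Z) : Prop :=
  ∀ ⦃y y' : ℕ → Y⦄ ⦃t : ℕ⦄, (∀ i ≤ t, y i = y' i) → F y t = F y' t

/-- The action of a causal transformation of paths on histories of length `t`. -/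
def onHistories (F : (ℕ → Y) → ℕ → Z) (t : ℕ) (h : Fin (t + 1) → Y) : Fin (t + 1) → Z :=
  history t (F (extendHistory h))

namespace IsCausal

variable {F : (ℕ → Y) → ℕ → Z}

theorem apply_extendHistory (hF : IsCausal F) (y : ℕ → Y) (hi : i ≤ t) :
    F (extendHistory (history t y)) i = F y i :=
  hF fun _ hj => extendHistory_history_of_le y (hj.trans hi)

theorem onHistories_comp_history (hF : IsCausal F) (t : ℕ) :
    onHistories F t ∘ history t = history t ∘ F :=
  funext fun y => funext fun i => hF.apply_extendHistory y (Nat.le_of_lt_succ i.2)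

end IsCausal

theorem measurable_onHistories [MeasurableSpace Y] [MeasurableSpace Z] {F : (ℕ → Y) → ℕ → Z}
    (hF : Measurable F) (t : ℕ) : Measurable (onHistories F t) :=
  (measurable_history t).comp (hF.comp (measurable_extendHistory t))

end History

namespace ControlPolicy

variable {X U : Type*} [MeasurableSpace X] [MeasurableSpace U] (φ : ControlPolicy X U)

/-- The control values that the policy `φ` produces along a state path. -/
def controls (x : ℕ → X) (t : ℕ) : U :=
  φ.rule t (fun i => x i, fun i => controls x i)
termination_by t
decreasing_by exact i.2

/-- The controlled path that the policy `φ` generates along a state path. -/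
def path (x : ℕ → X) (t : ℕ) : X × U :=
  (x t, φ.controls x t)

theorem isCausal_controls : IsCausal φ.controls := by
  intro x y t h
  induction t using Nat.strong_induction_on with
  | _ t ih =>
    have hstates : (fun i : Fin (t + 1) => x i) = fun i : Fin (t + 1) => y i :=
      funext fun i => h i (Nat.le_of_lt_succ i.2)
    have hcontrols : (fun i : Fin t => φ.controls x i) = fun i : Fin t => φ.controls y i :=
      funext fun i => ih i i.2 fun j hj => h j (hj.trans i.2.le)
    rw [controls, controls, hstates, hcontrols]

theorem isCausal_path : IsCausal φ.path := fun _ _ t h =>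
  Prod.ext (h t le_rfl) (φ.isCausal_controls h)

theorem measurable_controls : Measurable φ.controls := by
  refine measurable_pi_lambda _ fun t => ?_
  induction t using Nat.strong_induction_on with
  | _ t ih =>
    have hrule : (fun x => φ.controls x t) =
        fun x => φ.rule t (fun i => x i, fun i => φ.controls x i) := funext fun x => by
      rw [controls]
    rw [hrule]
    exact (φ.measurable_rule t).comp
      ((measurable_history t).prodMk (measurable_pi_lambda _ fun i => ih i i.2))

theorem measurable_path : Measurable φ.path :=
  measurable_pi_lambda _ fun t =>
    (measurable_pi_apply t).prodMk ((measurable_pi_apply t).comp φ.measurable_controls)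

variable {φ}

theorem countable_range_controls {t : ℕ} (hφ : (Set.range (φ.rule t)).Countable) :
    (Set.range fun x => φ.controls x t).Countable :=
  hφ.mono <| Set.range_subset_iff.2 fun x => by
    rw [controls]
    exact Set.mem_range_self _

theorem ae_map_path_eq [MeasurableSingletonClass U] {Ω : Type*} [MeasurableSpace Ω]
    {P : Measure Ω} (hφ : ∀ t, (Set.range (φ.rule t)).Countable) {x : Ω → ℕ → X}
    (hx : Measurable x) :
    ∀ᵐ ω ∂P.map (fun o => φ.path (x o)), φ.path (fun n => (ω n).1) = ω := by
  have hfst : Measurable fun (ω : ℕ → X × U) (n : ℕ) => (ω n).1 := by fun_prop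
  have hset : {ω : ℕ → X × U | φ.path (fun n => (ω n).1) = ω} =
      ⋂ t, {ω | (ω t).2 = φ.controls (fun n => (ω n).1) t} := by
    ext ω
    simp [funext_iff, Prod.ext_iff, path, eq_comm]
  have hmeas : MeasurableSet {ω : ℕ → X × U | φ.path (fun n => (ω n).1) = ω} :=
    hset ▸ .iInter fun t => measurableSet_eq_of_countable_range (by fun_prop)
      ((measurable_pi_apply t).comp (φ.measurable_controls.comp hfst))
      ((countable_range_controls (hφ t)).mono <| Set.range_comp_subset_range
        (fun (ω : ℕ → X × U) n => (ω n).1) fun x => φ.controls x t)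
  exact (ae_map_iff (φ.measurable_path.comp hx).aemeasurable hmeas).2 (.of_forall fun _ => rfl)

theorem rule_eq_of_path_eq {ω : ℕ → X × U} (h : φ.path (fun n => (ω n).1) = ω) (t : ℕ) :
    (ω t).2 = φ.rule t (fun i => (ω i).1, fun i => (ω i).2) := by
  rw [← h]
  exact controls.eq_1 ..

end ControlPolicy

theorem map_eval_zero_trajMeasure {X : ℕ → Type*} [∀ n, MeasurableSpace (X n)]
    (ν : Measure (X 0)) (K : (n : ℕ) → Kernel ((i : Finset.Iic n) → X i) (X (n + 1)))
    [∀ n, IsMarkovKernel (K n)] : (Kernel.trajMeasure ν K).map (fun x => x 0) = ν := by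
  let eval : ((i : Finset.Iic 0) → X i) → X 0 := fun h => h ⟨0, Finset.mem_Iic.2 le_rfl⟩
  have heval : Measurable eval := measurable_pi_apply _
  change (Kernel.trajMeasure ν K).map (eval ∘ Preorder.frestrictLe 0) = ν
  rw [← Measure.map_map heval (Preorder.measurable_frestrictLe 0), Kernel.trajMeasure,
    Measure.map_comp _ _ (Preorder.measurable_frestrictLe 0), Kernel.traj_map_frestrictLe,
    Kernel.partialTraj_self, Measure.id_comp]
  exact (Measure.map_map heval (MeasurableEquiv.measurable _)).trans Measure.map_id

section Existence

variable {X U AP : Type*} [MeasurableSpace X] [MeasurableSpace U]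

theorem exists_measure_hasCondDistrib_history (ν : Measure X) [IsProbabilityMeasure ν]
    (K : (t : ℕ) → Kernel (Fin (t + 1) → X) X) [∀ t, IsMarkovKernel (K t)] :
    ∃ μ : Measure (ℕ → X), IsProbabilityMeasure μ ∧ μ.map (fun x => x 0) = ν ∧
      ∀ t, HasCondDistrib (fun x => x (t + 1)) (history t) (K t) μ := by
  let reindex (t : ℕ) (h : Finset.Iic t → X) (i : Fin (t + 1)) : X :=
    h ⟨i, Finset.mem_Iic.2 (Nat.le_of_lt_succ i.2)⟩
  have hreindex : ∀ t, Measurable (reindex t) := fun t =>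
    measurable_pi_lambda _ fun _ => measurable_pi_apply _
  let K' (t : ℕ) : Kernel (Finset.Iic t → X) X := (K t).comap (reindex t) (hreindex t)
  refine ⟨Kernel.trajMeasure (X := fun _ => X) ν K', inferInstance,
    map_eval_zero_trajMeasure _ _, fun t => ?_⟩
  refine HasCondDistrib.comp_right (Z := Preorder.frestrictLe (π := fun _ => X) t)
    (hf := hreindex t) ⟨?_, ?_⟩
  · exact ((Preorder.measurable_frestrictLe t).prodMk (measurable_pi_apply _)).aemeasurable
  · exact Kernel.map_frestrictLe_trajMeasure_compProd_eq_map_trajMeasure.symm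

variable [StandardBorelSpace X] [Nonempty X]

theorem ControlPolicy.ae_condDistrib_map_path_eq (φ : ControlPolicy X U) {μ : Measure (ℕ → X)}
    [IsFiniteMeasure μ] {t : ℕ} {K : Kernel (Fin (t + 1) → X) X} [IsMarkovKernel K]
    (hK : HasCondDistrib (fun x => x (t + 1)) (history t) K μ) :
    ∀ᵐ ω ∂μ.map φ.path,
      condDistrib (fun ω' : ℕ → X × U => (ω' (t + 1)).1) (history t) (μ.map φ.path)
        (history t ω) = K (history t fun n => (ω n).1) := by
  let states (h : Fin (t + 1) → X × U) (i : Fin (t + 1)) : X := (h i).1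
  have hstates : Measurable states := by fun_prop
  have hK' : K = (K.comap states hstates).comap _
      (measurable_onHistories φ.measurable_path t) := by
    ext1 h
    refine congrArg K (funext fun i => ?_)
    exact congrArg h (Fin.ext (min_eq_left (Nat.le_of_lt_succ i.2)).symm)
  have hpath : HasCondDistrib (fun x => x (t + 1)) (history t ∘ φ.path)
      (K.comap states hstates) μ := by
    rw [← φ.isCausal_path.onHistories_comp_history]
    exact (hK' ▸ hK).comp_right
  refine ae_of_ae_map (measurable_history t).aemeasurable
    (p := fun h => condDistrib _ _ (μ.map φ.path) h = K.comap states hstates h) ?_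
  refine condDistrib_ae_eq_of_measure_eq_compProd _
    (measurable_pi_apply (t + 1)).fst.aemeasurable ?_
  rw [Measure.map_map (by fun_prop) φ.measurable_path,
    Measure.map_map (by fun_prop) φ.measurable_path]
  exact hpath.map_eq

theorem ControlledMarkovSystem.laws_nonempty [MeasurableSingletonClass U]
    (S : ControlledMarkovSystem X U AP) (hS : ∀ u, (S.trans u).Nonempty) {φ : ControlPolicy X U}
    (hφ : ∀ t, (Set.range (φ.rule t)).Countable) (ν : ProbabilityMeasure X) :
    (S.laws φ ν).Nonempty := by
  choose T hT using hS
  let K (t : ℕ) : Kernel (Fin (t + 1) → X) X :=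
    { toFun h := (T (φ.controls (extendHistory h) t)).1 (h (Fin.last t))
      measurable' := measurable_apply_of_countable_range (F := fun u => (T u).1)
        ((measurable_pi_apply t).comp (φ.measurable_controls.comp (measurable_extendHistory t)))
        (measurable_pi_apply _) (fun u => (T u).1.measurable)
        ((ControlPolicy.countable_range_controls (hφ t)).mono <|
          Set.range_comp_subset_range extendHistory fun x => φ.controls x t) }
  have : ∀ t, IsMarkovKernel (K t) := fun t => ⟨fun h => (T _).2.isProbabilityMeasure _⟩
  obtain ⟨μ, hμ, hinit, hstep⟩ := exists_measure_hasCondDistrib_history (ν : Measure X) K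
  have hpath : ∀ᵐ ω ∂μ.map φ.path, φ.path (fun n => (ω n).1) = ω :=
    ControlPolicy.ae_map_path_eq hφ measurable_id
  refine ⟨⟨μ.map φ.path, Measure.isProbabilityMeasure_map φ.measurable_path.aemeasurable⟩,
    ?_, fun t => hpath.mono fun ω hω => ControlPolicy.rule_eq_of_path_eq hω t, fun t => ?_⟩
  · exact (Measure.map_map (by fun_prop) φ.measurable_path).trans hinit
  · filter_upwards [hpath, φ.ae_condDistrib_map_path_eq (hstep t)] with ω hω hcond
    refine ⟨T (ω t).2, hT _, hcond.trans ?_⟩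
    change (T (φ.controls (extendHistory (history t fun n => (ω n).1)) t)).1 (ω t).1 = _
    rw [φ.isCausal_controls.apply_extendHistory _ le_rfl]
    exact congrArg (fun u => (T u).1 (ω t).1) (congrArg Prod.snd (congrFun hω t))

end Existence

section Averaging

variable {Ω X Q Act AP 𝓗 𝓕 : Type*} [MeasurableSpace Ω] [MeasurableSpace X] [MeasurableSpace Q]
  [MeasurableSpace 𝓗] [MeasurableSpace 𝓕] [MeasurableSingletonClass 𝓕]

theorem condDistrib_comp_eq_comp_cond [StandardBorelSpace X] [Nonempty X] [StandardBorelSpace Q]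
    [Nonempty Q] {P : Measure Ω} [IsFiniteMeasure P] {H : Ω → 𝓗} (hH : Measurable H) {Y : Ω → X}
    (hY : Measurable Y) {f : 𝓗 → 𝓕} (hf : Measurable f) {g : X → Q} (hg : Measurable g) {y : 𝓕}
    (hy : P.map (f ∘ H) {y} ≠ 0) :
    condDistrib (g ∘ Y) (f ∘ H) P y =
      (((condDistrib Y H P).map g).comap H hH) ∘ₘ P[|H ⁻¹' (f ⁻¹' {y})] := by
  have hfy : MeasurableSet (f ⁻¹' {y}) := hf (measurableSet_singleton y)
  ext s hs
  rw [condDistrib_apply_of_ne_zero (hg.comp hY) y hy,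
    Measure.map_apply (hf.comp hH) (measurableSet_singleton y),
    Measure.map_apply ((hf.comp hH).prodMk (hg.comp hY)) ((measurableSet_singleton y).prod hs),
    Measure.bind_apply hs (Kernel.aemeasurable _), ProbabilityTheory.cond, lintegral_smul_measure]
  simp only [Kernel.comap_apply, Kernel.map_apply' _ hg _ hs]
  rw [setLIntegral_preimage_condDistrib hH hY.aemeasurable (hg hs) hfy]
  rfl

variable [Countable Q] [DiscreteMeasurableSpace Q]

namespace BMDP

variable (B : BMDP Q Act AP) {a : Act} {i : Q}

theorem exists_mem_trans_eq_row (h : (B.toSystem.trans a).Nonempty) (μ : Measure Q)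
    [IsProbabilityMeasure μ] (hμ : ∀ j, μ.real {j} ∈ Set.Icc (B.lower a i j) (B.upper a i j)) :
    ∃ Θ ∈ B.toSystem.trans a, μ = Θ.1 i := by
  classical
  obtain ⟨Θ, hΘ⟩ := h
  have := Θ.2
  let Θ' : Kernel Q Q := .piecewise (measurableSet_singleton i) (.const Q μ) Θ.1
  have hself : Θ' i = μ := by simp [Θ', Kernel.piecewise_apply]
  refine ⟨⟨Θ', inferInstance⟩, fun k j => ?_, hself.symm⟩
  by_cases hk : k = i
  · rw [hk, hself]
    exact hμ j
  · have hother : Θ' k = Θ.1 k := by simp [Θ', Kernel.piecewise_apply, hk]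
    rw [hother]
    exact hΘ k j

/-- The bounds of a row cut out a closed convex set, so they survive averaging. -/
theorem exists_comp_eq_row {μ : Measure Ω} [IsProbabilityMeasure μ] {K : Kernel Ω Q}
    [IsMarkovKernel K] (hK : ∀ᵐ ω ∂μ, ∃ Θ ∈ B.toSystem.trans a, K ω = Θ.1 i) :
    ∃ Θ ∈ B.toSystem.trans a, K ∘ₘ μ = Θ.1 i := by
  obtain ⟨_, Θ, hΘ, -⟩ := hK.exists
  refine B.exists_mem_trans_eq_row ⟨Θ, hΘ⟩ _ fun j => ?_
  have hj : MeasurableSet {j} := measurableSet_singleton j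
  have hreal : (K ∘ₘ μ).real {j} = ∫ ω, (K ω).real {j} ∂μ := by
    rw [Measure.real, Measure.bind_apply hj K.aemeasurable]
    exact (integral_toReal (K.measurable_coe hj).aemeasurable
      (.of_forall fun ω => measure_lt_top _ _)).symm
  rw [hreal]
  refine (convex_Icc _ _).integral_mem isClosed_Icc (hK.mono ?_) ?_
  · rintro ω ⟨Θ, hΘ, hKω⟩
    exact hKω ▸ hΘ i j
  · exact .of_bound (K.measurable_coe hj).ennreal_toReal.aestronglyMeasurable 1
      (.of_forall fun ω => by simp [abs_of_nonneg])

theorem ae_exists_condDistrib_eq_row [StandardBorelSpace X] [Nonempty X] [Nonempty Q]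
    [Countable 𝓕] {P : Measure Ω} [IsFiniteMeasure P] {H : Ω → 𝓗} (hH : Measurable H) {Y : Ω → X}
    (hY : Measurable Y) {f : 𝓗 → 𝓕} (hf : Measurable f) {g : X → Q} (hg : Measurable g)
    {a : 𝓕 → Act} {i : 𝓕 → Q}
    (h : ∀ᵐ ω ∂P, ∃ Θ ∈ B.toSystem.trans (a (f (H ω))),
      (condDistrib Y H P (H ω)).map g = Θ.1 (i (f (H ω)))) :
    ∀ᵐ y ∂P.map (f ∘ H), ∃ Θ ∈ B.toSystem.trans (a y),
      condDistrib (g ∘ Y) (f ∘ H) P y = Θ.1 (i y) := by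
  refine ae_iff_of_countable.2 fun y hy => ?_
  have hA : MeasurableSet (H ⁻¹' (f ⁻¹' {y})) := hH (hf (measurableSet_singleton y))
  have hPA : P (H ⁻¹' (f ⁻¹' {y})) ≠ 0 := by
    rwa [Measure.map_apply (hf.comp hH) (measurableSet_singleton y)] at hy
  have := cond_isProbabilityMeasure hPA
  have := Kernel.IsMarkovKernel.map (condDistrib Y H P) hg
  rw [condDistrib_comp_eq_comp_cond hH hY hf hg hy]
  refine B.exists_comp_eq_row ?_
  filter_upwards [cond_absolutelyContinuous.ae_le h, ae_cond_mem hA] with ω ⟨Θ, hΘ, hrow⟩ hω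
  obtain rfl : f (H ω) = y := hω
  exact ⟨Θ, hΘ, by rwa [Kernel.comap_apply, Kernel.map_apply _ hg]⟩

end BMDP

end Averaging

section Abstraction

variable {X Z U Q Act AP : Type*} [MeasurableSpace X] [MeasurableSpace Q]
  {S : ControlledMarkovSystem X U AP} {A : ControlledMarkovSystem Q Act AP} {cell : X → Q}

/-- The concrete system simulates the abstract one when the states are abstracted by `cell` and an
abstract action `a` in the cell `q` is implemented by the control `sel (q, a)`: every transition
probability of that control, projected to cells, is a row that `a` permits in `q`. -/
def ControlledMarkovSystem.SimulatesVia (S : ControlledMarkovSystem X U AP)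
    (A : ControlledMarkovSystem Q Act AP) (cell : X → Q) (sel : Q × Act → U) : Prop :=
  ∀ p : Q × Act, ∀ T ∈ S.trans (sel p), ∀ x, cell x = p.1 →
    ∃ Θ ∈ A.trans p.2, (T.1 x).map cell = Θ.1 p.1

namespace Abstracts

variable {α : Set (X × Q)} {R : Set (ProbabilityMeasure X × ProbabilityMeasure Q)}

theorem label_cell (h : Abstracts S A α R) (hpre : ∀ q, relPreimage α q = cell ⁻¹' {q}) (x : X) :
    A.label (cell x) = S.label x := by
  obtain ⟨q, hq, hlabel⟩ := h.state_level x
  have hqx : cell x = q := (hpre q).subset hq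
  rw [hqx, hlabel]

theorem exists_simulatesVia [Countable Q] [DiscreteMeasurableSpace Q] (h : Abstracts S A α R)
    (hcell : Measurable cell) (hpre : ∀ q, relPreimage α q = cell ⁻¹' {q}) :
    ∃ sel : Q × Act → U, S.SimulatesVia A cell sel := by
  choose sel hsel using fun p : Q × Act => h.measure_level p.1 p.2
  refine ⟨sel, fun p T hT x hx => ?_⟩
  obtain ⟨Θ, hΘ, -, hrow⟩ := hsel p T hT x ((hpre p.1).superset hx)
  refine ⟨Θ, hΘ, Measure.ext_of_singleton fun q' => ?_⟩
  rw [Measure.map_apply hcell (measurableSet_singleton q'), ← hpre, hrow]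

end Abstracts

theorem IsMeasurablePartition.exists_cell [Countable Q] {α : Set (X × Q)}
    (hα : IsMeasurablePartition α) :
    ∃ cell : X → Q, Measurable cell ∧ ∀ q, relPreimage α q = cell ⁻¹' {q} := by
  choose cell hmem huniq using hα.1
  have hpre : ∀ q, relPreimage α q = cell ⁻¹' {q} := fun q =>
    Set.ext fun x => ⟨fun hx => (huniq x q hx).symm, fun hx => hx ▸ hmem x⟩
  exact ⟨cell, measurable_to_countable' fun q => hpre q ▸ hα.2 q, hpre⟩

theorem map_eq_dirac_of_preimage_singleton [MeasurableSingletonClass Q] {ν : Measure X}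
    [IsProbabilityMeasure ν] (hcell : Measurable cell) {q : Q} (h : ν (cell ⁻¹' {q}) = 1) :
    ν.map cell = Measure.dirac q := by
  have hae : cell =ᵐ[ν] fun _ => q :=
    (prob_compl_eq_zero_iff (hcell (measurableSet_singleton q))).2 h
  exact (hasLaw_dirac_of_ae_eq hae).map_eq

variable [MeasurableSpace U] [MeasurableSpace Act]

namespace ControlPolicy

variable (κ : ControlPolicy Q Act)

/-- The controlled path of the abstract system that the abstract policy `κ` generates along the
cells visited by a path. Here `Z` is either the concrete state space or its product with the
control space. -/
def abstractPath (cell : Z → Q) (z : ℕ → Z) : ℕ → Q × Act :=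
  κ.path fun n => cell (z n)

theorem isCausal_abstractPath (cell : Z → Q) : IsCausal (κ.abstractPath cell) :=
  fun _ _ _ h => κ.isCausal_path fun i hi => congrArg cell (h i hi)

theorem measurable_abstractPath [MeasurableSpace Z] {cell : Z → Q} (hcell : Measurable cell) :
    Measurable (κ.abstractPath cell) :=
  κ.measurable_path.comp <| measurable_pi_lambda _ fun n => hcell.comp (measurable_pi_apply n)

variable [Countable Q] [DiscreteMeasurableSpace Q] [Countable Act] [DiscreteMeasurableSpace Act]

/-- The refinement of the abstract policy `κ` to concrete states: it runs `κ` on the cells visited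
so far and applies the control that `sel` assigns to the current cell and action. The recorded
concrete controls are ignored because `κ` reproduces its own actions. -/
def refine (hcell : Measurable cell) (sel : Q × Act → U) : ControlPolicy X U where
  rule t h := sel (κ.abstractPath cell (extendHistory h.1) t)
  measurable_rule t := (Measurable.of_discrete (f := sel)).comp <| (measurable_pi_apply t).comp <|
    (κ.measurable_abstractPath hcell).comp <| (measurable_extendHistory t).comp measurable_fst

variable (hcell : Measurable cell) (sel : Q × Act → U) (t : ℕ)

theorem refine_rule_history (x : ℕ → X) (u : Fin t → U) :
    (κ.refine hcell sel).rule t (history t x, u) = sel (κ.abstractPath cell x t) :=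
  congrArg sel ((κ.isCausal_abstractPath cell).apply_extendHistory x le_rfl)

theorem countable_range_refine_rule : (Set.range ((κ.refine hcell sel).rule t)).Countable :=
  (Set.countable_range sel).mono <| Set.range_comp_subset_range
    (fun h : (Fin (t + 1) → X) × (Fin t → U) => κ.abstractPath cell (extendHistory h.1) t) sel

end ControlPolicy

namespace ControlledMarkovSystem

theorem satisfies_map_abstractPath_iff (κ : ControlPolicy Q Act) (hcell : Measurable cell)
    (hlabel : ∀ x, A.label (cell x) = S.label x) (P : ProbabilityMeasure (ℕ → X × U))
    (c : Comparison) (ρ : ℝ) {Ψ : Set (ℕ → Set AP)} (hΨ : MeasurableSet Ψ) :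
    A.Satisfies (P.map (κ.measurable_abstractPath (hcell.comp measurable_fst)).aemeasurable)
      c ρ Ψ ↔ S.Satisfies P c ρ Ψ := by
  have hmeas : MeasurableSet (A.satEvent (U := Act) Ψ) :=
    hΨ.preimage <| measurable_pi_lambda _ fun t =>
      A.measurable_label.comp (measurable_pi_apply t).fst
  have hevent : κ.abstractPath (fun z : X × U => cell z.1) ⁻¹' A.satEvent Ψ = S.satEvent Ψ := by
    ext ω
    change (fun t => A.label (cell (ω t).1)) ∈ Ψ ↔ (fun t => S.label (ω t).1) ∈ Ψ
    simp only [hlabel]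
  have hprob := map_measureReal_apply (μ := (P : Measure (ℕ → X × U)))
    (κ.measurable_abstractPath (hcell.comp measurable_fst)) hmeas
  unfold Satisfies
  rw [← hevent]
  exact iff_of_eq (congrArg (c.holds · ρ) hprob)

variable [StandardBorelSpace X] [Nonempty X] [Countable Q] [DiscreteMeasurableSpace Q]
  [Countable Act] [DiscreteMeasurableSpace Act] {B : BMDP Q Act AP} {sel : Q × Act → U}
  {κ : ControlPolicy Q Act} {ν : ProbabilityMeasure X} {P : ProbabilityMeasure (ℕ → X × U)}

theorem SimulatesVia.ae_exists_map_condDistrib_eq_row (hsim : S.SimulatesVia A cell sel)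
    (hcell : Measurable cell) (hP : P ∈ S.laws (κ.refine hcell sel) ν) (t : ℕ) :
    ∀ᵐ ω ∂(P : Measure (ℕ → X × U)),
      ∃ Θ ∈ A.trans (κ.abstractPath (fun z : X × U => cell z.1) ω t).2,
        (condDistrib (fun ω' : ℕ → X × U => (ω' (t + 1)).1) (history t)
          (P : Measure (ℕ → X × U)) (history t ω)).map cell =
            Θ.1 (κ.abstractPath (fun z : X × U => cell z.1) ω t).1 := by
  filter_upwards [hP.2.1 t, hP.2.2 t] with ω hctrl ⟨T, hT, hcond⟩
  have hsel : (ω t).2 = sel (κ.abstractPath (fun z : X × U => cell z.1) ω t) :=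
    hctrl.trans (κ.refine_rule_history hcell sel t (fun n => (ω n).1) _)
  obtain ⟨Θ, hΘ, hrow⟩ := hsim _ T (hsel ▸ hT) (ω t).1 rfl
  exact ⟨Θ, hΘ, (congrArg (Measure.map cell) hcond).trans hrow⟩

theorem SimulatesVia.ae_exists_condDistrib_map_abstractPath_eq_row [Nonempty Q]
    (hsim : S.SimulatesVia B.toSystem cell sel) (hcell : Measurable cell)
    (hP : P ∈ S.laws (κ.refine hcell sel) ν) (t : ℕ) :
    ∀ᵐ ω ∂(P : Measure (ℕ → X × U)).map (κ.abstractPath fun z => cell z.1),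
      ∃ Θ ∈ B.toSystem.trans (ω t).2,
        condDistrib (fun ω' : ℕ → Q × Act => (ω' (t + 1)).1) (history t)
          ((P : Measure (ℕ → X × U)).map (κ.abstractPath fun z => cell z.1)) (history t ω) =
            Θ.1 (ω t).1 := by
  let proj : (ℕ → X × U) → ℕ → Q × Act := κ.abstractPath fun z => cell z.1
  have hproj : Measurable proj := κ.measurable_abstractPath (hcell.comp measurable_fst)
  have hcomp : onHistories proj t ∘ history t = history t ∘ proj :=
    (κ.isCausal_abstractPath _).onHistories_comp_history t
  have hlast : ∀ ω, onHistories proj t (history t ω) (Fin.last t) = proj ω t := fun ω =>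
    congrFun (congrFun hcomp ω) (Fin.last t)
  refine ae_of_ae_map (measurable_history t).aemeasurable
    (p := fun y : Fin (t + 1) → Q × Act => ∃ Θ ∈ B.toSystem.trans (y (Fin.last t)).2,
      condDistrib _ _ _ y = Θ.1 (y (Fin.last t)).1) ?_
  rw [Measure.map_map (measurable_history t) hproj]
  have hmap := condDistrib_map (ν := (P : Measure (ℕ → X × U))) (f := proj) (X := history t)
    (Y := fun ω' : ℕ → Q × Act => (ω' (t + 1)).1) (measurable_history t).aemeasurable
    (measurable_pi_apply (t + 1)).fst.aemeasurable hproj.aemeasurable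
  have hrow := B.ae_exists_condDistrib_eq_row (P := (P : Measure (ℕ → X × U)))
    (H := history t) (Y := fun ω => (ω (t + 1)).1) (g := cell) (f := onHistories proj t)
    (a := fun y => (y (Fin.last t)).2) (i := fun y => (y (Fin.last t)).1)
    (measurable_history t) (measurable_pi_apply (t + 1)).fst (measurable_onHistories hproj t) hcell
    (by simpa only [hlast] using hsim.ae_exists_map_condDistrib_eq_row hcell hP t)
  rw [hcomp] at hrow
  filter_upwards [hmap, hrow] with y hy ⟨Θ, hΘ, hrow⟩
  exact ⟨Θ, hΘ, hy.trans hrow⟩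

theorem SimulatesVia.map_abstractPath_mem_laws [Nonempty Q]
    (hsim : S.SimulatesVia B.toSystem cell sel) (hcell : Measurable cell)
    (hP : P ∈ S.laws (κ.refine hcell sel) ν) :
    P.map (κ.measurable_abstractPath (hcell.comp measurable_fst)).aemeasurable ∈
      B.toSystem.laws κ (ν.map hcell.aemeasurable) := by
  have hproj := κ.measurable_abstractPath (hcell.comp (measurable_fst (β := U)))
  refine ⟨?_, fun t => ?_, hsim.ae_exists_condDistrib_map_abstractPath_eq_row hcell hP⟩
  · change ((P : Measure (ℕ → X × U)).map _).map _ = (ν : Measure X).map cell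
    rw [← hP.1, Measure.map_map (measurable_pi_apply 0).fst hproj,
      Measure.map_map hcell (measurable_pi_apply 0).fst]
    rfl
  · have hcells : Measurable fun (ω : ℕ → X × U) n => cell (ω n).1 :=
      measurable_pi_lambda _ fun n => hcell.comp (measurable_pi_apply n).fst
    exact (ControlPolicy.ae_map_path_eq (φ := κ) (fun _ => Set.to_countable _) hcells).mono
      fun ω hω => ControlPolicy.rule_eq_of_path_eq hω t

end ControlledMarkovSystem

end Abstraction

theorem mainTheorem4_general
    {X U Q Act AP : Type*} [MeasurableSpace X] [StandardBorelSpace X] [Nonempty X]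
    [MeasurableSpace U] [MeasurableSingletonClass U]
    [Countable Q] [Nonempty Q] [MeasurableSpace Q] [DiscreteMeasurableSpace Q]
    [Countable Act] [MeasurableSpace Act] [DiscreteMeasurableSpace Act]
    (XU : ControlledMarkovSystem X U AP) (hXU : ∀ u, (XU.trans u).Nonempty)
    (IA : BMDP Q Act AP)
    (α : Set (X × Q)) (hα : IsMeasurablePartition α)
    (R : Set (ProbabilityMeasure X × ProbabilityMeasure Q))
    (hR : Abstracts XU IA.toSystem α R)
    (Ψ : Set (ℕ → Set AP)) (hΨ : MeasurableSet Ψ)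
    (c : Comparison) (ρ : ℝ) (q₀ : Q)
    (κ : ControlPolicy Q Act)
    (hκ : ∀ P ∈ IA.toSystem.laws κ ⟨Measure.dirac q₀, inferInstance⟩,
      IA.toSystem.Satisfies P c ρ Ψ) :
    ∃ φ : ControlPolicy X U, ∀ ν₀ : ProbabilityMeasure X,
      (ν₀ : Measure X) (relPreimage α q₀) = 1 →
        (XU.laws φ ν₀).Nonempty ∧ ∀ P ∈ XU.laws φ ν₀, XU.Satisfies P c ρ Ψ := by
  obtain ⟨cell, hcell, hpre⟩ := hα.exists_cell
  obtain ⟨sel, hsim⟩ := hR.exists_simulatesVia hcell hpre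
  refine ⟨κ.refine hcell sel, fun ν₀ hν₀ =>
    ⟨XU.laws_nonempty hXU (κ.countable_range_refine_rule hcell sel) ν₀, fun P hP => ?_⟩⟩
  have hinit : ν₀.map hcell.aemeasurable = ⟨Measure.dirac q₀, inferInstance⟩ :=
    Subtype.ext (map_eq_dirac_of_preimage_singleton hcell (hpre q₀ ▸ hν₀))
  have hlaw := hsim.map_abstractPath_mem_laws hcell hP
  rw [hinit] at hlaw
  exact (XU.satisfies_map_abstractPath_iff κ hcell (hR.label_cell hpre) P c ρ hΨ).1 (hκ _ hlaw)

theorem mainTheorem4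
    {X U Q Act AP : Type*}
    [TopologicalSpace X] [PolishSpace X] [MeasurableSpace X] [BorelSpace X] [Nonempty X]
    [TopologicalSpace U] [CompactSpace U] [TopologicalSpace.MetrizableSpace U]
    [MeasurableSpace U] [BorelSpace U]
    [Finite Q] [Nonempty Q] [MeasurableSpace Q] [DiscreteMeasurableSpace Q]
    [Finite Act] [MeasurableSpace Act] [DiscreteMeasurableSpace Act]
    [Finite AP]
    (XU : ControlledMarkovSystem X U AP) (hXU : ∀ u, (XU.trans u).Nonempty)
    (IA : BMDP Q Act AP)
    (α : Set (X × Q)) (hα : IsMeasurablePartition α)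
    (R : Set (ProbabilityMeasure X × ProbabilityMeasure Q))
    (hR : Abstracts XU IA.toSystem α R)
    (Ψ : Set (ℕ → Set AP)) (hΨ : IsOmegaRegular Ψ)
    (c : Comparison) (ρ : ℝ) (hρ : ρ ∈ Set.Icc (0 : ℝ) 1)
    (q₀ : Q)
    (κ : ControlPolicy Q Act)
    (hκ : ∀ P ∈ IA.toSystem.laws κ ⟨Measure.dirac q₀, inferInstance⟩,
      IA.toSystem.Satisfies P c ρ Ψ) :
    ∃ φ : ControlPolicy X U, ∀ ν₀ : ProbabilityMeasure X,
      (ν₀ : Measure X) (relPreimage α q₀) = 1 →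
        (XU.laws φ ν₀).Nonempty ∧ ∀ P ∈ XU.laws φ ν₀, XU.Satisfies P c ρ Ψ :=
  mainTheorem4_general XU hXU IA α hα R hR Ψ hΨ.measurableSet c ρ q₀ κ hκ
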